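/- Let $\alpha\in(0,1]$, $H=1-\alpha/2$, $\nu\ge 0$, and let $\varepsilon=\varepsilon_n>0$ ($n\ge1$) satisfy $\varepsilon_n\asymp n^{-1/2}$ as $n\to\infty$. Let $K$ be an integrable (possibly measure-valued, e.g. a point mass) convolution kernel whose Fourier transform $\widetilde K[\omega]=\int e^{-2\pi i\omega x}K(x)\,dx$ satisfies $|\widetilde K[\omega]|\asymp|\omega|^{-\nu}$ over the nonzero integers $\omega$. Let $B_H$ be a fractional Brownian motion with Hurst index $H$ (with a.s. continuous paths) on $[0,1]$, $\widetilde Z_H[\ell]=\int_0^1 e^{-2\pi i\ell x}\,dB_H(x)$, and, for each $\ell\ge1$, let $\widetilde W_H[\ell]$ be distributed as $\widetilde Z_H[\ell]$ and independent of it. Put $\widetilde Y_e[\ell]=\widetilde K[\ell]+\varepsilon^\alpha\widetilde W_H[\ell]$ and $$M_c=\min\{\ell>0:|\widetilde K[\ell]|\le \ell^{\alpha/2}\varepsilon^\alpha(\log 1/\varepsilon^2)^{4/3}\},\quad M_d=\min\{\ell>0:|\widetilde K[\ell]|\le \ell^{\alpha/2}\varepsilon^\alpha(\log 1/\varepsilon^2)^{2/3}\},$$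 $$M=\min\{\ell>0:|\widetilde Y_e[\ell]|\le \ell^{\alpha/2}\varepsilon^\alpha\log 1/\varepsilon^2\}\quad(M=\infty\text{ if there is no such }\ell),\qquad 2^{j_1}=\Big(\frac{n^\alpha}{\log n}\Big)^{1/(\alpha+2\nu)}.$$ Let $\mathcal B=\bigcap_{\omega=1}^{M_d}\{|\varepsilon^\alpha\widetilde Z_H[\omega]|\le|\widetilde K[\omega]|/2\}$ and $\mathcal M=\{M_c\le M\le M_d\}$. Then there are constants $c,\xi,C>0$ and $N\in\mathbb N$, depending only on $\alpha,\nu,K$ and the sequence $(\varepsilon_n)$, such that: 1. for every $n\ge1$ with $\varepsilon_n<1$, the minima defining $M_c$ and $M_d$ are attained, and $$P(\mathcal B^c)\le c\,M_d\exp\{-(\log 1/\varepsilon)^{1+\xi}\}=:\Omega_n ;$$ 2. for every $n\ge N$, $P(\mathcal M^c)\le C\,\Omega_n$; 3. for every $n\ge N$, $M_c\le M_d\le M_1$, where $M_1=\lfloor 2^{j_1}\rfloor$. -/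

import Mathlib

open MeasureTheory ProbabilityTheory Filter Asymptotics Set

noncomputable section

namespace WaveletDeconv

/-- The Fourier transform `K̃[w] = ∫ e^{-2πiwx} K(x) dκ(x)` of the convolution kernel `K dκ`.
With `κ = volume` the kernel is the function `K` on the line, with `κ` the restriction of
`volume` to a period it is a periodic function, and with `κ` a Dirac mass at `0` it is the kernel
of the direct (well-posed) model. -/
def kernelFourier (κ : Measure ℝ) (K : ℝ → ℝ) (w : ℝ) : ℂ :=
  ∫ x, Complex.exp (-2 * Real.pi * Complex.I * w * x) * (K x : ℂ) ∂κ

open scoped FourierTransform in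
theorem kernelFourier_volume (K : ℝ → ℝ) (w : ℝ) :
    kernelFourier volume K w = 𝓕 (fun x => (K x : ℂ)) w := by
  rw [Real.fourier_real_eq_integral_exp_smul]
  unfold kernelFourier
  congr 1
  ext x
  rw [smul_eq_mul]
  congr 2
  push_cast
  ring

theorem kernelFourier_dirac (w : ℝ) : kernelFourier (Measure.dirac 0) (fun _ => 1) w = 1 := by
  simp [kernelFourier]

/-- Regular-smooth kernels of degree of ill-posedness `ν`: `|K̃[ω]| ≍ |ω|^{-ν}` over the nonzero
integer frequencies. -/
def IsRegularSmooth (ν : ℝ) (κ : Measure ℝ) (K : ℝ → ℝ) : Prop :=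
  ∃ a b : ℝ, 0 < a ∧ 0 < b ∧ ∀ ω : ℤ, ω ≠ 0 →
    a * |(ω : ℝ)| ^ (-ν) ≤ ‖kernelFourier κ K ω‖ ∧ ‖kernelFourier κ K ω‖ ≤ b * |(ω : ℝ)| ^ (-ν)

/-- `B` is, on the time interval `[0,1]`, a fractional Brownian motion with Hurst index `H`
(with almost surely continuous paths). The values of `B` outside `[0,1]` are irrelevant. -/
structure IsFractionalBrownianMotion {Ω : Type*} [MeasurableSpace Ω] (H : ℝ) (B : ℝ → Ω → ℝ)
    (P : Measure Ω) : Prop where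
  gaussian : IsGaussianProcess (fun (t : Icc (0 : ℝ) 1) => B t) P
  centered : ∀ t ∈ Icc (0 : ℝ) 1, ∫ ω, B t ω ∂P = 0
  covariance : ∀ s ∈ Icc (0 : ℝ) 1, ∀ t ∈ Icc (0 : ℝ) 1,
    ∫ ω, B t ω * B s ω ∂P = (1 / 2) * (|s| ^ (2 * H) + |t| ^ (2 * H) - |t - s| ^ (2 * H))
  continuous_paths : ∀ᵐ ω ∂P, ContinuousOn (fun t => B t ω) (Icc 0 1)

/-- The integral `∫₀¹ f(x) db(x)` of a continuously differentiable function `f` against a continuous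
path `b` (the limit of the Riemann–Stieltjes sums), given by integration by parts. -/
def pathIntegral (f : ℝ → ℂ) (b : ℝ → ℝ) : ℂ :=
  f 1 * (b 1 : ℂ) - f 0 * (b 0 : ℂ) - ∫ x in (0 : ℝ)..1, deriv f x * (b x : ℂ)

/-- The Fourier coefficient `Z̃_H[ℓ] = ∫₀¹ e^{-2πiℓx} dB(x)` of the noise. -/
def noiseFourier {Ω : Type*} (B : ℝ → Ω → ℝ) (l : ℕ) (ω : Ω) : ℂ :=
  pathIntegral (fun x => Complex.exp (-2 * Real.pi * Complex.I * l * x)) (fun x => B x ω)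

/-- The frequencies `ℓ > 0` at which `a ℓ ≤ ℓ^{α/2} ε^α (log (1/ε²))^p`. -/
def lowFrequencies (α ε p : ℝ) (a : ℕ → ℝ) : Set ℕ :=
  {l | 0 < l ∧ a l ≤ (l : ℝ) ^ (α / 2) * ε ^ α * Real.log (1 / ε ^ 2) ^ p}

/-- The deterministic frequency level
`min {ℓ > 0 : |K̃[ℓ]| ≤ ℓ^{α/2} ε^α (log (1/ε²))^p}`. -/
def frequencyLevel (κ : Measure ℝ) (K : ℝ → ℝ) (α ε p : ℝ) : ℕ :=
  sInf (lowFrequencies α ε p fun l => ‖kernelFourier κ K l‖)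

/-- `M_c`: the frequency level with exponent `4/3`. -/
def Mc (κ : Measure ℝ) (K : ℝ → ℝ) (α ε : ℝ) : ℕ := frequencyLevel κ K α ε (4 / 3)

/-- `M_d`: the frequency level with exponent `2/3`. -/
def Md (κ : Measure ℝ) (K : ℝ → ℝ) (α ε : ℝ) : ℕ := frequencyLevel κ K α ε (2 / 3)

/-- The observed coefficients `Ỹ_e[ℓ] = K̃[ℓ] + ε^α W[ℓ]`. -/
def observed {Ω : Type*} (κ : Measure ℝ) (K : ℝ → ℝ) (α ε : ℝ) (W : ℕ → Ω → ℂ) (l : ℕ) (ω : Ω) :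
    ℂ :=
  kernelFourier κ K l + ((ε ^ α : ℝ) : ℂ) * W l ω

/-- The Fourier stopping time `M = min {ℓ > 0 : |Ỹ_e[ℓ]| ≤ ℓ^{α/2} ε^α log (1/ε²)}`, equal to `⊤`
if there is no such `ℓ`. -/
def stoppingTime {Ω : Type*} (κ : Measure ℝ) (K : ℝ → ℝ) (α ε : ℝ) (W : ℕ → Ω → ℂ) (ω : Ω) : ℕ∞ :=
  ⨅ l ∈ lowFrequencies α ε 1 (fun l => ‖observed κ K α ε W l ω‖), (l : ℕ∞)

/-- The event `ℬ = ⋂_{1 ≤ l ≤ M_d} {|ε^α Z̃_H[l]| ≤ |K̃[l]|/2}`. -/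
def eventB {Ω : Type*} (κ : Measure ℝ) (K : ℝ → ℝ) (α ε : ℝ) (B : ℝ → Ω → ℝ) : Set Ω :=
  {ω | ∀ l : ℕ, 1 ≤ l → l ≤ Md κ K α ε →
    ‖((ε ^ α : ℝ) : ℂ) * noiseFourier B l ω‖ ≤ ‖kernelFourier κ K l‖ / 2}

/-- The event `ℳ = {M_c ≤ M ≤ M_d}`. -/
def eventM {Ω : Type*} (κ : Measure ℝ) (K : ℝ → ℝ) (α ε : ℝ) (W : ℕ → Ω → ℂ) : Set Ω :=
  {ω | (Mc κ K α ε : ℕ∞) ≤ stoppingTime κ K α ε W ω ∧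
    stoppingTime κ K α ε W ω ≤ (Md κ K α ε : ℕ∞)}

/-- `Ω_n = c M_d exp (-(log (1/ε))^{1+ξ})`. -/
def tailBound (κ : Measure ℝ) (K : ℝ → ℝ) (α ε c ξ : ℝ) : ℝ :=
  c * (Md κ K α ε : ℝ) * Real.exp (-(Real.log (1 / ε) ^ (1 + ξ)))

/-- `2^{j₁} = (n^α / log n)^{1/(α+2ν)}`. -/
def fineResolution (α ν : ℝ) (n : ℕ) : ℝ :=
  ((n : ℝ) ^ α / Real.log n) ^ (1 / (α + 2 * ν))

end WaveletDeconv

end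

namespace WaveletDeconv

/-! Write `L = log (1/ε²)`. Everything rests on a Gaussian tail at the right scale, `P(|Z̃[l]| ≥ t)
≤ 2 exp (-t² / (64π² l^α))` (`measure_noiseFourier_ge_le`). After integration by parts, the
derivative of `e^{-2πilx}` has mean zero on each cell of the grid `ℤ / l`, so `B` may be replaced by
its increment from the last grid point. That increment has standard deviation at most `l^{-H}`; the
derivative contributes `2πl`, and `l^{1-H} = l^{α/2}`. Jensen's inequality for `exp (s y²)`, Tonelli
and Markov give the tail.

If `ℬ` or `ℳ` fails, some noise coefficient with `l ≤ M_d` exceeds a constant times `l^{α/2}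
L^{2/3}`. Each such exceedance has probability at most `2 exp (-s L^{4/3})`, with `s` free of `l`,
and a union bound supplies the factor `M_d`. Since `4/3 > 7/6`, the constant `s` is absorbed and `ξ
= 1/6` works.

At `m = ⌊2^{j₁}⌋` the ratio of the threshold of `M_d` to `m^{-ν}` is at least of order `(log n)^{2/3
- 1/2}`, which diverges; hence `M_d ≤ m` eventually. -/

/-! ### Pathwise bound for Fourier coefficients through increments below scale `1 / l`. -/

theorem floor_mul_div_mem_Icc {l : ℕ} (hl : 1 ≤ l) {x : ℝ} (hx : x ∈ Icc (0 : ℝ) 1) :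
    (⌊(l : ℝ) * x⌋ : ℝ) / l ∈ Icc (0 : ℝ) 1 := by
  have hl' : (0 : ℝ) < l := by exact_mod_cast hl
  have h0 : (0 : ℝ) ≤ ⌊(l : ℝ) * x⌋ := by
    exact_mod_cast Int.floor_nonneg.2 (mul_nonneg hl'.le hx.1)
  refine ⟨by positivity, ?_⟩
  rw [div_le_one hl']
  exact (Int.floor_le _).trans (by nlinarith [hx.2])

theorem abs_sub_floor_mul_div_le {l : ℕ} (hl : 1 ≤ l) (x : ℝ) :
    |x - (⌊(l : ℝ) * x⌋ : ℝ) / l| ≤ (l : ℝ)⁻¹ := by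
  have hl' : (0 : ℝ) < l := by exact_mod_cast hl
  have h1 := Int.floor_le ((l : ℝ) * x)
  have h2 := Int.lt_floor_add_one ((l : ℝ) * x)
  have : x - (⌊(l : ℝ) * x⌋ : ℝ) / l = (l * x - ⌊(l : ℝ) * x⌋) * (l : ℝ)⁻¹ := by
    field_simp
  rw [this, abs_of_nonneg (mul_nonneg (by linarith) (by positivity))]
  exact mul_le_of_le_one_left (by positivity) (by linarith)

/-- The exponential `x ↦ e^{-2πilx}`. -/
noncomputable def fourierExp (l : ℕ) (x : ℝ) : ℂ :=
  Complex.exp (-2 * Real.pi * Complex.I * l * x)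

theorem hasDerivAt_fourierExp (l : ℕ) (x : ℝ) :
    HasDerivAt (fourierExp l) (-2 * Real.pi * Complex.I * l * fourierExp l x) x := by
  have h : HasDerivAt (fun z : ℂ => Complex.exp (-2 * Real.pi * Complex.I * l * z))
      (Complex.exp (-2 * Real.pi * Complex.I * l * x) * (-2 * Real.pi * Complex.I * l * 1)) x :=
    ((hasDerivAt_id (x : ℂ)).const_mul _).cexp
  convert! h.comp_ofReal using 1
  simp only [fourierExp]
  ring

theorem norm_fourierExp (l : ℕ) (x : ℝ) : ‖fourierExp l x‖ = 1 := by
  have : -2 * Real.pi * Complex.I * l * x = ((-2 * Real.pi * l * x : ℝ) : ℂ) * Complex.I := by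
    push_cast
    ring
  rw [fourierExp, this, Complex.norm_exp_ofReal_mul_I]

theorem fourierExp_div {l : ℕ} (hl : 1 ≤ l) (k : ℕ) : fourierExp l ((k : ℝ) / l) = 1 := by
  have hl' : (l : ℂ) ≠ 0 := by
    exact_mod_cast (by omega : l ≠ 0)
  rw [fourierExp, Complex.exp_eq_one_iff]
  refine ⟨-k, ?_⟩
  push_cast
  field_simp

theorem norm_deriv_fourierExp (l : ℕ) (x : ℝ) :
    ‖deriv (fourierExp l) x‖ = 2 * Real.pi * l := by
  rw [(hasDerivAt_fourierExp l x).deriv, norm_mul, norm_fourierExp]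
  simp [abs_of_pos Real.pi_pos]

theorem continuous_deriv_fourierExp (l : ℕ) : Continuous (deriv (fourierExp l)) := by
  have : deriv (fourierExp l) = fun x => -2 * Real.pi * Complex.I * l * fourierExp l x := by
    funext x
    exact (hasDerivAt_fourierExp l x).deriv
  rw [this]
  unfold fourierExp
  fun_prop

/-- The derivative of `e^{-2πilx}` integrates to zero against step functions on `ℤ / l`. -/
theorem integral_deriv_fourierExp_mul_floor {l : ℕ} (hl : 1 ≤ l) (b : ℝ → ℝ) :
    ∫ x in (0 : ℝ)..1, deriv (fourierExp l) x * (b (⌊(l : ℝ) * x⌋ / l) : ℂ) = 0 := by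
  have hl' : (0 : ℝ) < l := by exact_mod_cast hl
  have hle : ∀ k : ℕ, (k : ℝ) / l ≤ ((k + 1 : ℕ) : ℝ) / l := fun k => by
    gcongr
    simp
  -- Open cells: the floor jumps at the right endpoint, which is a null set.
  have hcongr : ∀ k : ℕ, ∀ x ∈ Ioo ((k : ℝ) / l) (((k + 1 : ℕ) : ℝ) / l),
      deriv (fourierExp l) x * (b (k / l) : ℂ) =
        deriv (fourierExp l) x * (b (⌊(l : ℝ) * x⌋ / l) : ℂ) := by
    intro k x hx
    have : ⌊(l : ℝ) * x⌋ = k := by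
      rw [Int.floor_eq_iff]
      have h1 := (div_lt_iff₀ hl').1 hx.1
      have h2 := (lt_div_iff₀ hl').1 hx.2
      push_cast at h2 ⊢
      constructor <;> nlinarith
    rw [this]
    simp
  have hint : ∀ k : ℕ, IntervalIntegrable
      (fun x => deriv (fourierExp l) x * (b (k / l) : ℂ)) volume ((k : ℝ) / l)
      (((k + 1 : ℕ) : ℝ) / l) := fun k =>
    ((continuous_deriv_fourierExp l).mul continuous_const).intervalIntegrable _ _
  have hsum := intervalIntegral.sum_integral_adjacent_intervals
    (f := fun x => deriv (fourierExp l) x * (b (⌊(l : ℝ) * x⌋ / l) : ℂ))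
    (a := fun k : ℕ => (k : ℝ) / l) (μ := volume) (n := l) (fun k _ => by
      refine (hint k).congr_ae ?_
      rw [uIoc_of_le (hle k), ← Measure.restrict_congr_set Ioo_ae_eq_Ioc]
      exact (ae_restrict_iff' measurableSet_Ioo).2 (ae_of_all _ (hcongr k)))
  simp only [Nat.cast_zero, zero_div, div_self hl'.ne'] at hsum
  rw [← hsum]
  refine Finset.sum_eq_zero fun k _ => ?_
  have : ∫ x in ((k : ℝ) / l)..(((k + 1 : ℕ) : ℝ) / l),
      deriv (fourierExp l) x * (b (⌊(l : ℝ) * x⌋ / l) : ℂ) =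
      ∫ x in ((k : ℝ) / l)..(((k + 1 : ℕ) : ℝ) / l),
        deriv (fourierExp l) x * (b (k / l) : ℂ) := by
    rw [intervalIntegral.integral_of_le (hle k), intervalIntegral.integral_of_le (hle k),
      integral_Ioc_eq_integral_Ioo, integral_Ioc_eq_integral_Ioo]
    exact setIntegral_congr_fun measurableSet_Ioo fun x hx => (hcongr k x hx).symm
  rw [this, intervalIntegral.integral_mul_const, intervalIntegral.integral_deriv_eq_sub
    (fun x _ => (hasDerivAt_fourierExp l x).differentiableAt)
    ((continuous_deriv_fourierExp l).intervalIntegrable _ _),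
    fourierExp_div hl, fourierExp_div hl, sub_self, zero_mul]

/-- The oscillation of a path below the scale `1 / l`. -/
noncomputable def fineIncrement (l : ℕ) (b : ℝ → ℝ) (x : ℝ) : ℝ :=
  b x - b (⌊(l : ℝ) * x⌋ / l)

theorem aestronglyMeasurable_fineIncrement (l : ℕ) {b : ℝ → ℝ}
    (hb : ContinuousOn b (Icc 0 1)) :
    AEStronglyMeasurable (fineIncrement l b) (volume.restrict (Ioc 0 1)) := by
  refine ((hb.mono Ioc_subset_Icc_self).aestronglyMeasurable measurableSet_Ioc).sub ?_
  -- This function factors through `ℤ`, so `b` itself need not be measurable.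
  have : Measurable fun x : ℝ => b (⌊(l : ℝ) * x⌋ / l) :=
    (measurable_from_top (f := fun k : ℤ => b (k / l))).comp
      (Int.measurable_floor.comp (measurable_id.const_mul _))
  exact this.aestronglyMeasurable

theorem exists_abs_fineIncrement_le {l : ℕ} (hl : 1 ≤ l) {b : ℝ → ℝ}
    (hb : ContinuousOn b (Icc 0 1)) :
    ∃ C, ∀ x ∈ Icc (0 : ℝ) 1, |fineIncrement l b x| ≤ C := by
  obtain ⟨C, hC⟩ := isCompact_Icc.exists_bound_of_continuousOn hb
  refine ⟨C + C, fun x hx => ?_⟩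
  exact (abs_sub _ _).trans (add_le_add (hC x hx) (hC _ (floor_mul_div_mem_Icc hl hx)))

/-- The exponential equals 1 at both endpoints, and subtracting the grid values of `b` leaves the
integral against the derivative unchanged. The boundary term is kept under the integral so that
Jensen applies to the whole bound. -/
theorem norm_pathIntegral_le {l : ℕ} (hl : 1 ≤ l) {b : ℝ → ℝ} (hb : ContinuousOn b (Icc 0 1)) :
    ‖pathIntegral (fourierExp l) b‖ ≤
      ∫ x in Ioc (0 : ℝ) 1, (|b 1 - b 0| + 2 * Real.pi * l * |fineIncrement l b x|) := by
  obtain ⟨C, hC⟩ := exists_abs_fineIncrement_le hl hb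
  have hfin : Integrable (fineIncrement l b) (volume.restrict (Ioc 0 1)) :=
    Integrable.of_bound (aestronglyMeasurable_fineIncrement l hb) C
      ((ae_restrict_iff' measurableSet_Ioc).2
        (ae_of_all _ fun x hx => hC x (Ioc_subset_Icc_self hx)))
  have hb' : Integrable b (volume.restrict (Ioc 0 1)) :=
    (hb.integrableOn_Icc).mono_set Ioc_subset_Icc_self
  have hfl : Integrable (fun x : ℝ => b (⌊(l : ℝ) * x⌋ / l)) (volume.restrict (Ioc 0 1)) := by
    convert! hb'.sub hfin using 1
    funext x
    simp [fineIncrement]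
  have hmul : ∀ {g : ℝ → ℝ}, Integrable g (volume.restrict (Ioc 0 1)) →
      Integrable (fun x => deriv (fourierExp l) x * (g x : ℂ)) (volume.restrict (Ioc 0 1)) := by
    intro g hg
    refine hg.ofReal.bdd_mul (c := 2 * Real.pi * l)
      (continuous_deriv_fourierExp l).aestronglyMeasurable (ae_of_all _ fun x => ?_)
    rw [norm_deriv_fourierExp]
  have hrep : ∫ x in (0 : ℝ)..1, deriv (fourierExp l) x * (b x : ℂ) =
      ∫ x in Ioc (0 : ℝ) 1, deriv (fourierExp l) x * (fineIncrement l b x : ℂ) := by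
    rw [← sub_zero (∫ x in (0 : ℝ)..1, deriv (fourierExp l) x * (b x : ℂ)),
      ← integral_deriv_fourierExp_mul_floor hl b,
      intervalIntegral.integral_of_le zero_le_one, intervalIntegral.integral_of_le zero_le_one,
      ← integral_sub (hmul hb') (hmul hfl)]
    refine integral_congr_ae (ae_of_all _ fun x => ?_)
    simp only [fineIncrement]
    push_cast
    ring
  have h0 : fourierExp l 0 = 1 := by simp [fourierExp]
  have h1 : fourierExp l 1 = 1 := by
    simpa [div_self (show (l : ℝ) ≠ 0 by exact_mod_cast (by omega : l ≠ 0))] using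
      fourierExp_div hl l
  rw [pathIntegral, hrep, h0, h1, integral_add (integrable_const _) (hfin.abs.const_mul _),
    integral_const_mul]
  refine (norm_sub_le _ _).trans (add_le_add ?_ ?_)
  · rw [one_mul, one_mul, ← Complex.ofReal_sub, Complex.norm_real]
    simp
  · refine (norm_integral_le_integral_norm _).trans (le_of_eq ?_)
    rw [← integral_const_mul]
    refine integral_congr_ae (ae_of_all _ fun x => ?_)
    simp only [norm_mul, norm_deriv_fourierExp, Complex.norm_real, Real.norm_eq_abs]

/-! ### Exponential moments, first pathwise and then under the Gaussian law. -/

/-- Separates the increment over `[0,1]` from the fine increment: they are correlated, but after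
this only their individual laws matter. -/
theorem exp_mul_sq_le_average {s : ℝ} (hs : 0 ≤ s) (u v : ℝ) :
    Real.exp (s * (u + v) ^ 2) ≤
      (1 / 2) * Real.exp (4 * s * u ^ 2) + (1 / 2) * Real.exp (4 * s * v ^ 2) := by
  have h1 : s * (u + v) ^ 2 ≤ (1 / 2) * (4 * s * u ^ 2) + (1 / 2) * (4 * s * v ^ 2) := by
    nlinarith [mul_nonneg hs (sq_nonneg (u - v))]
  refine (Real.exp_le_exp.2 h1).trans ?_
  have := convexOn_exp.2 (mem_univ (4 * s * u ^ 2)) (mem_univ (4 * s * v ^ 2))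
    (by norm_num : (0 : ℝ) ≤ 1 / 2) (by norm_num : (0 : ℝ) ≤ 1 / 2) (by norm_num)
  simpa only [smul_eq_mul] using this

theorem convexOn_exp_mul_sq {s : ℝ} (hs : 0 ≤ s) :
    ConvexOn ℝ univ fun y : ℝ => Real.exp (s * y ^ 2) := by
  have h : ConvexOn ℝ univ fun y : ℝ => s * y ^ 2 := by
    simpa using (Even.convexOn_pow (𝕜 := ℝ) (n := 2) (by norm_num)).smul hs
  refine ⟨convex_univ, fun x hx y hy a b ha hb hab => ?_⟩
  exact (Real.exp_le_exp.2 (h.2 hx hy ha hb hab)).trans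
    (convexOn_exp.2 (mem_univ _) (mem_univ _) ha hb hab)

/-- The integrand that dominates `exp (s |∫₀¹ e^{-2πilx} db(x)|²)`. -/
noncomputable def expMajorant (s : ℝ) (l : ℕ) (b : ℝ → ℝ) (x : ℝ) : ENNReal :=
  ENNReal.ofReal ((1 / 2) * Real.exp (4 * s * (b 1 - b 0) ^ 2) +
    (1 / 2) * Real.exp (16 * Real.pi ^ 2 * s * l ^ 2 * fineIncrement l b x ^ 2))

theorem ofReal_exp_norm_pathIntegral_le {l : ℕ} (hl : 1 ≤ l) {s : ℝ} (hs : 0 ≤ s) {b : ℝ → ℝ}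
    (hb : ContinuousOn b (Icc 0 1)) :
    ENNReal.ofReal (Real.exp (s * ‖pathIntegral (fourierExp l) b‖ ^ 2)) ≤
      ∫⁻ x in Ioc (0 : ℝ) 1, expMajorant s l b x := by
  simp only [expMajorant]
  -- Jensen's inequality needs total mass one.
  have : IsProbabilityMeasure (volume.restrict (Ioc (0 : ℝ) 1)) := ⟨by simp⟩
  obtain ⟨C, hC⟩ := exists_abs_fineIncrement_le hl hb
  set g : ℝ → ℝ := fun x => |b 1 - b 0| + 2 * Real.pi * l * |fineIncrement l b x| with hg
  have hgm : AEStronglyMeasurable g (volume.restrict (Ioc 0 1)) :=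
    aestronglyMeasurable_const.add
      ((aestronglyMeasurable_fineIncrement l hb).norm.const_mul (2 * Real.pi * l))
  have hg0 : ∀ x, 0 ≤ g x := fun x => by positivity
  have hgb : ∀ x ∈ Ioc (0 : ℝ) 1, g x ≤ |b 1 - b 0| + 2 * Real.pi * l * C := fun x hx => by
    have := hC x (Ioc_subset_Icc_self hx)
    simp only [hg]
    gcongr
  have hgi : Integrable g (volume.restrict (Ioc 0 1)) :=
    Integrable.of_bound hgm (|b 1 - b 0| + 2 * Real.pi * l * C)
      ((ae_restrict_iff' measurableSet_Ioc).2 (ae_of_all _ fun x hx => by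
        rw [Real.norm_of_nonneg (hg0 x)]
        exact hgb x hx))
  have hcont : Continuous fun y : ℝ => Real.exp (s * y ^ 2) := by fun_prop
  have hei : Integrable ((fun y : ℝ => Real.exp (s * y ^ 2)) ∘ g) (volume.restrict (Ioc 0 1)) :=
    Integrable.of_bound (hcont.comp_aestronglyMeasurable hgm)
      (Real.exp (s * (|b 1 - b 0| + 2 * Real.pi * l * C) ^ 2))
      ((ae_restrict_iff' measurableSet_Ioc).2 (ae_of_all _ fun x hx => by
        simp only [Function.comp_apply, Real.norm_eq_abs, Real.abs_exp]
        have := hgb x hx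
        have := hg0 x
        gcongr))
  have hJ := (convexOn_exp_mul_sq hs).map_integral_le hcont.continuousOn isClosed_univ
    (ae_of_all _ fun x => mem_univ (g x)) hgi hei
  calc ENNReal.ofReal (Real.exp (s * ‖pathIntegral (fourierExp l) b‖ ^ 2))
      ≤ ENNReal.ofReal (∫ x in Ioc (0 : ℝ) 1, Real.exp (s * g x ^ 2)) := by
        refine ENNReal.ofReal_le_ofReal (le_trans ?_ hJ)
        have := norm_pathIntegral_le hl hb
        gcongr
    _ = ∫⁻ x in Ioc (0 : ℝ) 1, ENNReal.ofReal (Real.exp (s * g x ^ 2)) :=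
        ofReal_integral_eq_lintegral_ofReal hei (ae_of_all _ fun x => (Real.exp_pos _).le)
    _ ≤ _ := by
        refine lintegral_mono fun x => ENNReal.ofReal_le_ofReal ?_
        refine (exp_mul_sq_le_average hs _ _).trans (le_of_eq ?_)
        rw [mul_pow _ |fineIncrement l b x|, sq_abs, sq_abs]
        ring_nf

open scoped NNReal ENNReal Topology

/-- Half of the Gaussian exponent survives: the integrand is at most the density of variance `2v`
times `√2`. -/
theorem lintegral_exp_mul_sq_gaussianReal_le {v : ℝ≥0} {c : ℝ} (hc : c * v ≤ 1 / 4) :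
    ∫⁻ x, ENNReal.ofReal (Real.exp (c * x ^ 2)) ∂(gaussianReal 0 v) ≤ 2 := by
  -- The degenerate law does occur: the fine increment vanishes at grid points.
  rcases eq_or_ne v 0 with rfl | hv
  · rw [gaussianReal_zero_var, lintegral_dirac]
    simp
  have hv' : (0 : ℝ) < v := by positivity
  have hb : (0 : ℝ) < 1 / (4 * v) := by positivity
  rw [gaussianReal_of_var_ne_zero 0 hv,
    lintegral_withDensity_eq_lintegral_mul _ (measurable_gaussianPDF 0 v) (by fun_prop)]
  calc ∫⁻ x, (gaussianPDF 0 v * fun x => ENNReal.ofReal (Real.exp (c * x ^ 2))) x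
      ≤ ∫⁻ x, ENNReal.ofReal ((√(2 * Real.pi * v))⁻¹ * Real.exp (-(1 / (4 * v)) * x ^ 2)) := by
        refine lintegral_mono fun x => ?_
        rw [Pi.mul_apply, gaussianPDF, ← ENNReal.ofReal_mul (gaussianPDFReal_nonneg 0 v x)]
        refine ENNReal.ofReal_le_ofReal ?_
        rw [gaussianPDFReal, mul_assoc, ← Real.exp_add]
        gcongr
        have h1 : c ≤ 1 / (4 * v) := by
          rw [le_div_iff₀ (by positivity)]
          linarith
        have h2 : -(x - 0) ^ 2 / (2 * (v : ℝ)) + 1 / (4 * v) * x ^ 2 = -(1 / (4 * v)) * x ^ 2 := by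
          field_simp
          ring
        nlinarith [mul_le_mul_of_nonneg_right h1 (sq_nonneg x)]
    _ = ENNReal.ofReal ((√(2 * Real.pi * v))⁻¹ * √(Real.pi / (1 / (4 * v)))) := by
        rw [← ofReal_integral_eq_lintegral_ofReal
          ((integrable_exp_neg_mul_sq hb).const_mul _) (ae_of_all _ fun x => by positivity),
          integral_const_mul, integral_gaussian]
    _ ≤ 2 := by
        rw [← ENNReal.ofReal_ofNat]
        refine ENNReal.ofReal_le_ofReal ?_
        rw [inv_mul_le_iff₀ (by positivity)]
        refine Real.sqrt_le_iff.2 ⟨by positivity, ?_⟩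
        rw [mul_pow, Real.sq_sqrt (by positivity)]
        have : Real.pi / (1 / (4 * v)) = 4 * (Real.pi * v) := by field_simp
        rw [this]
        nlinarith [mul_pos Real.pi_pos hv']

theorem noiseFourier_eq {Ω : Type*} (B : ℝ → Ω → ℝ) (l : ℕ) (ω : Ω) :
    noiseFourier B l ω = pathIntegral (fourierExp l) (fun x => B x ω) := rfl

variable {Ω : Type*} [MeasurableSpace Ω] {P : Measure Ω} {H : ℝ} {B : ℝ → Ω → ℝ}

namespace IsFractionalBrownianMotion

theorem hasGaussianLaw_sub (h : IsFractionalBrownianMotion H B P) {s t : ℝ}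
    (hs : s ∈ Icc (0 : ℝ) 1) (ht : t ∈ Icc (0 : ℝ) 1) :
    HasGaussianLaw (fun ω => B t ω - B s ω) P :=
  h.gaussian.hasGaussianLaw_fun_sub (s := ⟨t, ht⟩) (t := ⟨s, hs⟩)

theorem memLp_two (h : IsFractionalBrownianMotion H B P) {t : ℝ} (ht : t ∈ Icc (0 : ℝ) 1) :
    MemLp (B t) 2 P :=
  (h.gaussian.hasGaussianLaw_eval ⟨t, ht⟩).memLp_two

theorem variance_sub (h : IsFractionalBrownianMotion H B P) (hH : 0 < H) {s t : ℝ}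
    (hs : s ∈ Icc (0 : ℝ) 1) (ht : t ∈ Icc (0 : ℝ) 1) :
    Var[fun ω => B t ω - B s ω; P] = |t - s| ^ (2 * H) := by
  have := h.gaussian.isProbabilityMeasure
  have hmt := h.memLp_two ht
  have hms := h.memLp_two hs
  have hit := hmt.integrable one_le_two
  have his := hms.integrable one_le_two
  rw [show (fun ω => B t ω - B s ω) = B t - B s from rfl, variance_eq_sub (hmt.sub hms)]
  have h0 : ∫ ω, (B t ω - B s ω) ∂P = 0 := by
    rw [integral_sub hit his, h.centered t ht, h.centered s hs, sub_zero]
  have h2 : ∫ ω, (B t ω - B s ω) ^ 2 ∂P =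
      ∫ ω, B t ω * B t ω ∂P + ∫ ω, B s ω * B s ω ∂P - 2 * ∫ ω, B t ω * B s ω ∂P := by
    have htt : Integrable (fun ω => B t ω * B t ω) P := hmt.integrable_mul hmt
    have hss : Integrable (fun ω => B s ω * B s ω) P := hms.integrable_mul hms
    have hts : Integrable (fun ω => B t ω * B s ω) P := hmt.integrable_mul hms
    rw [← integral_const_mul, ← integral_add htt hss, ← integral_sub
      (show Integrable (fun ω => B t ω * B t ω + B s ω * B s ω) P from htt.add hss)
      (hts.const_mul 2)]
    refine integral_congr_ae (ae_of_all _ fun ω => ?_)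
    ring
  -- Needs `H > 0`, since `0 ^ 0 = 1`.
  have h0' : (0 : ℝ) ^ (2 * H) = 0 := Real.zero_rpow (by positivity)
  simp only [Pi.pow_apply, Pi.sub_apply]
  rw [h0, h2, h.covariance t ht t ht, h.covariance s hs s hs, h.covariance s hs t ht,
    sub_self, sub_self, abs_zero, h0']
  ring

theorem lintegral_exp_mul_sq_sub_le (h : IsFractionalBrownianMotion H B P) (hH : 0 < H)
    {s t c : ℝ} (hs : s ∈ Icc (0 : ℝ) 1) (ht : t ∈ Icc (0 : ℝ) 1)
    (hc : c * |t - s| ^ (2 * H) ≤ 1 / 4) :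
    ∫⁻ ω, ENNReal.ofReal (Real.exp (c * (B t ω - B s ω) ^ 2)) ∂P ≤ 2 := by
  have := h.gaussian.isProbabilityMeasure
  have hg := h.hasGaussianLaw_sub hs ht
  have hlaw := hg.map_eq_gaussianReal
  have hmean : ∫ ω, (B t ω - B s ω) ∂P = 0 := by
    rw [integral_sub ((h.memLp_two ht).integrable one_le_two)
      ((h.memLp_two hs).integrable one_le_two), h.centered t ht, h.centered s hs, sub_zero]
  rw [hmean, h.variance_sub hH hs ht] at hlaw
  rw [← lintegral_map' (f := fun x => ENNReal.ofReal (Real.exp (c * x ^ 2)))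
    (g := fun ω => B t ω - B s ω) (by fun_prop) hg.aemeasurable, hlaw]
  refine lintegral_exp_mul_sq_gaussianReal_le ?_
  rwa [Real.coe_toNNReal _ (by positivity)]

/-- The discretizations of `B` on the grid `ℤ / m` are jointly measurable. -/
theorem aemeasurable_floor (h : IsFractionalBrownianMotion H B P) {m : ℕ} (hm : 1 ≤ m) :
    AEMeasurable (fun p : ℝ × Ω => B (⌊(m : ℝ) * p.1⌋ / m) p.2)
      ((volume.restrict (Ioc 0 1)).prod P) := by
  have := h.gaussian.isProbabilityMeasure
  have hB : ∀ t : Icc (0 : ℝ) 1, AEMeasurable (B t) P := h.gaussian.aemeasurable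
  classical
  set B' : ℤ → Ω → ℝ := fun k => if hk : (k : ℝ) / m ∈ Icc (0 : ℝ) 1 then (hB ⟨_, hk⟩).mk else 0
    with hB'
  have hmeas : ∀ k, Measurable (B' k) := fun k => by
    simp only [hB']
    split_ifs with hk
    · exact (hB ⟨_, hk⟩).measurable_mk
    · exact measurable_const
  -- The grid is countable, so one null set serves all its points.
  have hae : ∀ᵐ ω ∂P, ∀ k : ℤ, (k : ℝ) / m ∈ Icc (0 : ℝ) 1 → B (k / m) ω = B' k ω := by
    refine ae_all_iff.2 fun k => ?_
    by_cases hk : (k : ℝ) / m ∈ Icc (0 : ℝ) 1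
    · filter_upwards [(hB ⟨_, hk⟩).ae_eq_mk] with ω hω _
      simp only [hB', hk, dite_true]
      exact hω
    · exact ae_of_all _ fun ω hk' => absurd hk' hk
  refine ⟨fun p => B' ⌊(m : ℝ) * p.1⌋ p.2, ?_, ?_⟩
  · have h1 : Measurable fun q : ℤ × Ω => B' q.1 q.2 :=
      measurable_from_prod_countable_right hmeas
    exact h1.comp ((Int.measurable_floor.comp (measurable_fst.const_mul _)).prodMk measurable_snd)
  · have h1 : ∀ᵐ p ∂((volume.restrict (Ioc (0 : ℝ) 1)).prod P), p.1 ∈ Ioc (0 : ℝ) 1 :=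
      Measure.quasiMeasurePreserving_fst.ae (ae_restrict_mem measurableSet_Ioc)
    filter_upwards [h1, Measure.quasiMeasurePreserving_snd.ae hae] with p hp hp'
    exact hp' _ (floor_mul_div_mem_Icc hm (Ioc_subset_Icc_self hp))

/-- Tonelli needs joint measurability, whereas the process is given as measurable at each fixed
time; path continuity makes it an almost everywhere limit of its discretizations. -/
theorem aemeasurable_uncurry (h : IsFractionalBrownianMotion H B P) :
    AEMeasurable (fun p : ℝ × Ω => B p.1 p.2) ((volume.restrict (Ioc 0 1)).prod P) := by
  have := h.gaussian.isProbabilityMeasure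
  refine aemeasurable_of_tendsto_metrizable_ae atTop
    (fun m : ℕ => h.aemeasurable_floor (m := m + 1) (by omega)) ?_
  have h1 : ∀ᵐ p ∂((volume.restrict (Ioc (0 : ℝ) 1)).prod P), p.1 ∈ Ioc (0 : ℝ) 1 :=
    Measure.quasiMeasurePreserving_fst.ae (ae_restrict_mem measurableSet_Ioc)
  filter_upwards [h1, Measure.quasiMeasurePreserving_snd.ae h.continuous_paths] with p hp hc
  have hp' := Ioc_subset_Icc_self hp
  have hlim : Tendsto (fun m : ℕ => (⌊((m + 1 : ℕ) : ℝ) * p.1⌋ : ℝ) / (m + 1 : ℕ)) atTop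
      (𝓝 p.1) := by
    rw [tendsto_iff_norm_sub_tendsto_zero]
    refine squeeze_zero (fun _ => norm_nonneg _) (fun m => ?_)
      (tendsto_inv_atTop_nhds_zero_nat.comp (tendsto_add_atTop_nat 1))
    rw [Real.norm_eq_abs, abs_sub_comm]
    exact abs_sub_floor_mul_div_le (by omega) _
  exact (hc p.1 hp').tendsto.comp (tendsto_nhdsWithin_iff.2
    ⟨hlim, Eventually.of_forall fun m => floor_mul_div_mem_Icc (by omega) hp'⟩)

theorem aemeasurable_expMajorant (h : IsFractionalBrownianMotion H B P) (s : ℝ) {l : ℕ}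
    (hl : 1 ≤ l) :
    AEMeasurable (fun p : ℝ × Ω => expMajorant s l (fun x => B x p.2) p.1)
      ((volume.restrict (Ioc 0 1)).prod P) := by
  have := h.gaussian.isProbabilityMeasure
  have hB01 : AEMeasurable (fun ω => B 1 ω - B 0 ω) P :=
    (h.hasGaussianLaw_sub (by simp) (by simp)).aemeasurable
  have hfine : AEMeasurable (fun p : ℝ × Ω => fineIncrement l (fun x => B x p.2) p.1)
      ((volume.restrict (Ioc 0 1)).prod P) :=
    h.aemeasurable_uncurry.sub (h.aemeasurable_floor hl)
  have h2 : AEMeasurable (fun p : ℝ × Ω => B 1 p.2 - B 0 p.2)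
      ((volume.restrict (Ioc 0 1)).prod P) :=
    hB01.comp_quasiMeasurePreserving Measure.quasiMeasurePreserving_snd
  have hcont : Measurable fun q : ℝ × ℝ => ENNReal.ofReal ((1 / 2) * Real.exp (4 * s * q.1 ^ 2) +
    (1 / 2) * Real.exp (16 * Real.pi ^ 2 * s * l ^ 2 * q.2 ^ 2)) := by fun_prop
  have hcomp := hcont.comp_aemeasurable (h2.prodMk hfine)
  simp only [expMajorant]
  exact hcomp

/-- `B 1 - B 0` has variance 1 and the fine increment variance at most `l^{-2H}`; `h1` and `h2` say
that both exponential moments are in the admissible range. -/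
theorem lintegral_expMajorant_le (h : IsFractionalBrownianMotion H B P) (hH : 0 < H) {s : ℝ}
    {l : ℕ} (hl : 1 ≤ l) (hs : 0 ≤ s) (h1 : 4 * s ≤ 1 / 4)
    (h2 : 16 * Real.pi ^ 2 * s * l ^ 2 * ((l : ℝ)⁻¹) ^ (2 * H) ≤ 1 / 4) {x : ℝ}
    (hx : x ∈ Icc (0 : ℝ) 1) :
    ∫⁻ ω, expMajorant s l (fun x => B x ω) x ∂P ≤ 2 := by
  have hfl := floor_mul_div_mem_Icc hl hx
  have e1 := h.lintegral_exp_mul_sq_sub_le hH (s := 0) (t := 1) (c := 4 * s) (by simp) (by simp)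
    (by simpa using h1)
  have e2 := h.lintegral_exp_mul_sq_sub_le hH hfl hx (c := 16 * Real.pi ^ 2 * s * l ^ 2)
    (by
      refine le_trans ?_ h2
      have hd := abs_sub_floor_mul_div_le hl x
      gcongr)
  have hm1 : AEMeasurable (fun ω => ENNReal.ofReal (Real.exp (4 * s * (B 1 ω - B 0 ω) ^ 2))) P :=
    (show Measurable fun y : ℝ => ENNReal.ofReal (Real.exp (4 * s * y ^ 2)) by
      fun_prop).comp_aemeasurable
      (h.hasGaussianLaw_sub (s := 0) (t := 1) (by simp) (by simp)).aemeasurable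
  have hm2 : AEMeasurable (fun ω => ENNReal.ofReal (Real.exp (16 * Real.pi ^ 2 * s * l ^ 2 *
      (B x ω - B (⌊(l : ℝ) * x⌋ / l) ω) ^ 2))) P :=
    (show Measurable fun y : ℝ =>
      ENNReal.ofReal (Real.exp (16 * Real.pi ^ 2 * s * l ^ 2 * y ^ 2)) by
      fun_prop).comp_aemeasurable (h.hasGaussianLaw_sub hfl hx).aemeasurable
  calc ∫⁻ ω, expMajorant s l (fun x => B x ω) x ∂P = ENNReal.ofReal (1 / 2) *
        ∫⁻ ω, ENNReal.ofReal (Real.exp (4 * s * (B 1 ω - B 0 ω) ^ 2)) ∂P +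
        ENNReal.ofReal (1 / 2) * ∫⁻ ω, ENNReal.ofReal (Real.exp (16 * Real.pi ^ 2 * s * l ^ 2 *
          (B x ω - B (⌊(l : ℝ) * x⌋ / l) ω) ^ 2)) ∂P := by
        rw [← lintegral_const_mul'' _ hm1, ← lintegral_const_mul'' _ hm2,
          ← lintegral_add_left' (hm1.const_mul _)]
        refine lintegral_congr fun ω => ?_
        rw [expMajorant, fineIncrement, ENNReal.ofReal_add (by positivity) (by positivity),
          ENNReal.ofReal_mul (by norm_num), ENNReal.ofReal_mul (by norm_num)]
    _ ≤ ENNReal.ofReal (1 / 2) * 2 + ENNReal.ofReal (1 / 2) * 2 := by gcongr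
    _ = 2 := by
        rw [← mul_add, ← ENNReal.ofReal_ofNat, ← ENNReal.ofReal_add (by norm_num) (by norm_num),
          ← ENNReal.ofReal_mul (by norm_num)]
        norm_num

end IsFractionalBrownianMotion

/-- Gaussian tail bound for the Fourier coefficients of fractional noise. -/
theorem IsFractionalBrownianMotion.measure_noiseFourier_ge_le {α : ℝ} (hα0 : 0 ≤ α)
    (hα : α ≤ 1) (h : IsFractionalBrownianMotion (1 - α / 2) B P) {l : ℕ} (hl : 1 ≤ l)
    {t : ℝ} (ht : 0 ≤ t) :
    P {ω | t ≤ ‖noiseFourier B l ω‖} ≤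
      ENNReal.ofReal (2 * Real.exp (-((64 * Real.pi ^ 2)⁻¹ * (t ^ 2 / (l : ℝ) ^ α)))) := by
  have := h.gaussian.isProbabilityMeasure
  have hl' : (1 : ℝ) ≤ l := by exact_mod_cast hl
  have hl0 : (0 : ℝ) < l := by linarith
  have hlα : 1 ≤ (l : ℝ) ^ α := Real.one_le_rpow hl' hα0
  -- Chosen so that `16π² s l² l^{-2H} = 16π² s l^α` is exactly `1/4`.
  obtain ⟨s, hsdef⟩ : ∃ s, s = (64 * Real.pi ^ 2)⁻¹ / (l : ℝ) ^ α := ⟨_, rfl⟩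
  have hs : 0 ≤ s := by
    rw [hsdef]
    positivity
  have h1 : 4 * s ≤ 1 / 4 := by
    have h2 : s ≤ (64 * Real.pi ^ 2)⁻¹ := hsdef ▸ div_le_self (by positivity) hlα
    have h3 : (64 * Real.pi ^ 2)⁻¹ ≤ (16 : ℝ)⁻¹ := by
      gcongr
      nlinarith [Real.pi_gt_three]
    linarith
  have h2 : 16 * Real.pi ^ 2 * s * l ^ 2 * ((l : ℝ)⁻¹) ^ (2 * (1 - α / 2)) = 1 / 4 := by
    have : ((l : ℝ)⁻¹) ^ (2 * (1 - α / 2)) = (l : ℝ) ^ α / l ^ 2 := by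
      rw [Real.inv_rpow hl0.le, ← Real.rpow_neg hl0.le,
        show -(2 * (1 - α / 2)) = α - (2 : ℕ) by push_cast; ring, Real.rpow_sub_natCast hl0.ne']
    rw [this, hsdef]
    have := Real.pi_pos
    field_simp
    norm_num
  have hm := h.aemeasurable_expMajorant s hl
  have hswap : ∫⁻ ω, (∫⁻ x in Ioc (0 : ℝ) 1, expMajorant s l (fun x => B x ω) x) ∂P =
      ∫⁻ x in Ioc (0 : ℝ) 1, (∫⁻ ω, expMajorant s l (fun x => B x ω) x ∂P) :=
    (lintegral_lintegral_swap (f := fun x ω => expMajorant s l (fun x => B x ω) x) hm).symm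
  have htotal : ∫⁻ ω, (∫⁻ x in Ioc (0 : ℝ) 1, expMajorant s l (fun x => B x ω) x) ∂P ≤ 2 := by
    rw [hswap]
    refine (setLIntegral_mono' measurableSet_Ioc fun x hx =>
      h.lintegral_expMajorant_le (by linarith) hl hs h1 h2.le (Ioc_subset_Icc_self hx)).trans ?_
    simp
  have hFω : AEMeasurable
      (fun ω => ∫⁻ x in Ioc (0 : ℝ) 1, expMajorant s l (fun x => B x ω) x) P :=
    AEMeasurable.lintegral_prod_left'
      (f := fun p : ℝ × Ω => expMajorant s l (fun x => B x p.2) p.1) hm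
  have hpos : 0 < Real.exp (s * t ^ 2) := Real.exp_pos _
  have hmarkov := meas_ge_le_lintegral_div hFω (ε := ENNReal.ofReal (Real.exp (s * t ^ 2)))
    (ENNReal.ofReal_pos.2 hpos).ne' ENNReal.ofReal_ne_top
  have hsub : ∀ᵐ ω ∂P, t ≤ ‖noiseFourier B l ω‖ → ENNReal.ofReal (Real.exp (s * t ^ 2)) ≤
      ∫⁻ x in Ioc (0 : ℝ) 1, expMajorant s l (fun x => B x ω) x := by
    filter_upwards [h.continuous_paths] with ω hω ht'
    refine le_trans (ENNReal.ofReal_le_ofReal ?_) (ofReal_exp_norm_pathIntegral_le hl hs hω)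
    rw [← noiseFourier_eq]
    gcongr
  refine (measure_mono_ae hsub).trans (hmarkov.trans ((ENNReal.div_le_div_right htotal _).trans
    (le_of_eq ?_)))
  rw [← ENNReal.ofReal_ofNat, ← ENNReal.ofReal_div_of_pos hpos, div_eq_mul_inv, ← Real.exp_neg,
    hsdef]
  ring_nf

/-! ### Deterministic frequency levels. -/

theorem log_one_div_sq (ε : ℝ) : Real.log (1 / ε ^ 2) = 2 * Real.log (1 / ε) := by
  rw [← one_div_pow, Real.log_pow]
  norm_num

theorem log_one_div_pos {ε : ℝ} (h0 : 0 < ε) (h1 : ε < 1) : 0 < Real.log (1 / ε) :=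
  Real.log_pos ((one_lt_div h0).2 h1)

theorem log_one_div_sq_pos {ε : ℝ} (h0 : 0 < ε) (h1 : ε < 1) : 0 < Real.log (1 / ε ^ 2) := by
  rw [log_one_div_sq]
  linarith [log_one_div_pos h0 h1]

theorem IsRegularSmooth.exists_bounds {ν : ℝ} {κ : Measure ℝ} {K : ℝ → ℝ}
    (h : IsRegularSmooth ν κ K) :
    ∃ a b : ℝ, 0 < a ∧ 0 < b ∧ ∀ l : ℕ, 1 ≤ l →
      a * (l : ℝ) ^ (-ν) ≤ ‖kernelFourier κ K l‖ ∧ ‖kernelFourier κ K l‖ ≤ b * (l : ℝ) ^ (-ν) := by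
  obtain ⟨a, b, ha, hb, hab⟩ := h
  refine ⟨a, b, ha, hb, fun l hl => ?_⟩
  simpa using hab l (by exact_mod_cast (by omega : l ≠ 0))

section LowFrequencies

variable {α ν ε p a b : ℝ} {k : ℕ → ℝ}

/-- The coefficients stay below `b` while `l^{α/2}` is unbounded. -/
theorem lowFrequencies_nonempty (hα : 0 < α) (h0 : 0 < ε) (h1 : ε < 1) (hν : 0 ≤ ν)
    (hb : 0 < b) (hk : ∀ l : ℕ, 1 ≤ l → k l ≤ b * (l : ℝ) ^ (-ν)) :
    (lowFrequencies α ε p k).Nonempty := by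
  have hL := log_one_div_sq_pos h0 h1
  have hlim : Tendsto (fun l : ℕ => (l : ℝ) ^ (α / 2)) atTop atTop :=
    (tendsto_rpow_atTop (by positivity)).comp tendsto_natCast_atTop_atTop
  obtain ⟨l, hl, hl1⟩ := ((hlim.eventually_ge_atTop
    (b / (ε ^ α * Real.log (1 / ε ^ 2) ^ p))).and (eventually_ge_atTop 1)).exists
  refine ⟨l, hl1, ?_⟩
  rw [div_le_iff₀ (by positivity)] at hl
  have hl1' : (1 : ℝ) ≤ l := by exact_mod_cast hl1
  calc k l ≤ b * (l : ℝ) ^ (-ν) := hk l hl1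
    _ ≤ b * 1 := by
        gcongr
        exact Real.rpow_le_one_of_one_le_of_nonpos hl1' (by linarith)
    _ ≤ _ := by linarith

theorem lt_of_lt_sInf_lowFrequencies {l : ℕ} (hl : 1 ≤ l)
    (h : l < sInf (lowFrequencies α ε p k)) :
    (l : ℝ) ^ (α / 2) * ε ^ α * Real.log (1 / ε ^ 2) ^ p < k l := by
  by_contra! hle
  exact Nat.notMem_of_lt_sInf h ⟨hl, hle⟩

theorem sInf_lowFrequencies_anti {q : ℝ} (hpq : p ≤ q) (hL : 1 ≤ Real.log (1 / ε ^ 2))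
    (hε : 0 ≤ ε) (hne : (lowFrequencies α ε p k).Nonempty) :
    sInf (lowFrequencies α ε q k) ≤ sInf (lowFrequencies α ε p k) := by
  obtain ⟨h1, h2⟩ := Nat.sInf_mem hne
  exact Nat.sInf_le ⟨h1, h2.trans (by gcongr)⟩

/-- Below the frequency level with exponent `2 / 3`, the coefficients of the kernel dominate
`l^{α/2} ε^α (log (1/ε²))^{2/3}` up to a constant; at the level itself this rests on their
regularity. -/
theorem exists_mul_le_of_le_sInf_lowFrequencies (hα : 0 < α) (hα1 : α ≤ 1) (hν : 0 ≤ ν)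
    (ha : 0 < a) (hb : 0 < b)
    (hk : ∀ l : ℕ, 1 ≤ l → a * (l : ℝ) ^ (-ν) ≤ k l ∧ k l ≤ b * (l : ℝ) ^ (-ν)) :
    ∃ c, 0 < c ∧ c ≤ 1 ∧ ∀ ε : ℝ, 0 < ε → ε < 1 → ∀ l : ℕ, 1 ≤ l →
      l ≤ sInf (lowFrequencies α ε (2 / 3) k) →
      c * ((l : ℝ) ^ (α / 2) * ε ^ α * Real.log (1 / ε ^ 2) ^ (2 / 3 : ℝ)) ≤ k l := by
  -- One entry per case: strictly below the level, level equal to 1, level above 1.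
  obtain ⟨c, hc⟩ : ∃ c, c = min 1 (min (a * (α / 2)) (a / b * 2⁻¹ ^ ν * 2⁻¹ ^ (α / 2))) :=
    ⟨_, rfl⟩
  have hc1 : c ≤ 1 := hc ▸ min_le_left _ _
  have hc2 : c ≤ a * (α / 2) := hc ▸ (min_le_right _ _).trans (min_le_left _ _)
  have hc3 : c ≤ a / b * 2⁻¹ ^ ν * 2⁻¹ ^ (α / 2) :=
    hc ▸ (min_le_right _ _).trans (min_le_right _ _)
  have hc0 : 0 < c := by
    rw [hc]
    positivity
  refine ⟨c, hc0, hc1, fun ε h0 h1 l hl hle => ?_⟩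
  have hL := log_one_div_sq_pos h0 h1
  rcases hle.lt_or_eq with hlt | heq
  · refine le_trans ?_ (lt_of_lt_sInf_lowFrequencies hl hlt).le
    exact mul_le_of_le_one_left (by positivity) hc1
  rcases hl.eq_or_lt with rfl | hl2
  -- There is no earlier frequency to compare with; instead `ε^α L^{2/3} ≤ (1 + L) e^{-αL/2} ≤ 2/α`.
  · have hεα : ε ^ α = Real.exp (-(α / 2 * Real.log (1 / ε ^ 2))) := by
      rw [log_one_div_sq, one_div, Real.log_inv, Real.rpow_def_of_pos h0]
      ring_nf
    have hL23 : Real.log (1 / ε ^ 2) ^ (2 / 3 : ℝ) ≤ 1 + Real.log (1 / ε ^ 2) := by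
      calc Real.log (1 / ε ^ 2) ^ (2 / 3 : ℝ) ≤ (1 + Real.log (1 / ε ^ 2)) ^ (2 / 3 : ℝ) := by
            gcongr
            linarith
        _ ≤ (1 + Real.log (1 / ε ^ 2)) ^ (1 : ℝ) :=
            Real.rpow_le_rpow_of_exponent_le (by linarith) (by norm_num)
        _ = _ := Real.rpow_one _
    have hexp : α / 2 * (1 + Real.log (1 / ε ^ 2)) ≤ Real.exp (α / 2 * Real.log (1 / ε ^ 2)) := by
      linarith [Real.add_one_le_exp (α / 2 * Real.log (1 / ε ^ 2))]
    have hk1 := (hk 1 le_rfl).1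
    simp only [Nat.cast_one, Real.one_rpow, mul_one, one_mul] at hk1 ⊢
    refine le_trans ?_ hk1
    rw [hεα, Real.exp_neg, mul_comm (_⁻¹), ← div_eq_mul_inv, ← mul_div_assoc,
      div_le_iff₀ (Real.exp_pos _)]
    calc c * Real.log (1 / ε ^ 2) ^ (2 / 3 : ℝ)
        ≤ a * (α / 2) * (1 + Real.log (1 / ε ^ 2)) := by gcongr
      _ = a * (α / 2 * (1 + Real.log (1 / ε ^ 2))) := by ring
      _ ≤ _ := by gcongr
  -- The preceding frequency `m` lies strictly below the level; passing from `m` to `m + 1 ≤ 2m`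
  -- costs only constants.
  · obtain ⟨m, rfl⟩ : ∃ m, l = m + 1 := ⟨l - 1, by omega⟩
    have hm : 1 ≤ m := by omega
    have hm' : (1 : ℝ) ≤ m := by exact_mod_cast hm
    have hlow := lt_of_lt_sInf_lowFrequencies hm (show m < _ by rw [← heq]; omega)
    have hupm := (hk m hm).2
    have hlowl := (hk (m + 1) hl).1
    have hcast : ((m + 1 : ℕ) : ℝ) ≤ 2 * m := by
      push_cast
      linarith
    have hpos : (0 : ℝ) < ((m + 1 : ℕ) : ℝ) := by positivity
    have e1 : 2⁻¹ ^ ν * (m : ℝ) ^ (-ν) ≤ ((m + 1 : ℕ) : ℝ) ^ (-ν) := by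
      rw [Real.inv_rpow (by norm_num), ← Real.rpow_neg (by norm_num),
        ← Real.mul_rpow (by norm_num) (by positivity)]
      exact Real.rpow_le_rpow_of_nonpos hpos hcast (by linarith)
    have e2 : 2⁻¹ ^ (α / 2) * ((m + 1 : ℕ) : ℝ) ^ (α / 2) ≤ (m : ℝ) ^ (α / 2) := by
      rw [← Real.mul_rpow (by norm_num) hpos.le]
      gcongr
      linarith
    have hT : 0 < ε ^ α * Real.log (1 / ε ^ 2) ^ (2 / 3 : ℝ) := by positivity
    calc c * (((m + 1 : ℕ) : ℝ) ^ (α / 2) * ε ^ α * Real.log (1 / ε ^ 2) ^ (2 / 3 : ℝ))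
        = c * ((m + 1 : ℕ) : ℝ) ^ (α / 2) * (ε ^ α * Real.log (1 / ε ^ 2) ^ (2 / 3 : ℝ)) := by ring
      _ ≤ a / b * 2⁻¹ ^ ν * 2⁻¹ ^ (α / 2) * ((m + 1 : ℕ) : ℝ) ^ (α / 2) *
          (ε ^ α * Real.log (1 / ε ^ 2) ^ (2 / 3 : ℝ)) := by gcongr
      _ = a / b * 2⁻¹ ^ ν * (2⁻¹ ^ (α / 2) * ((m + 1 : ℕ) : ℝ) ^ (α / 2)) *
          (ε ^ α * Real.log (1 / ε ^ 2) ^ (2 / 3 : ℝ)) := by ring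
      _ ≤ a / b * 2⁻¹ ^ ν * (m : ℝ) ^ (α / 2) *
          (ε ^ α * Real.log (1 / ε ^ 2) ^ (2 / 3 : ℝ)) := by gcongr
      _ = a / b * 2⁻¹ ^ ν * ((m : ℝ) ^ (α / 2) * ε ^ α * Real.log (1 / ε ^ 2) ^ (2 / 3 : ℝ)) := by
          ring
      _ ≤ a / b * 2⁻¹ ^ ν * (b * (m : ℝ) ^ (-ν)) := by
          exact mul_le_mul_of_nonneg_left (hlow.le.trans hupm) (by positivity)
      _ = a * (2⁻¹ ^ ν * (m : ℝ) ^ (-ν)) := by field_simp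
      _ ≤ a * ((m + 1 : ℕ) : ℝ) ^ (-ν) := by gcongr
      _ ≤ k (m + 1) := hlowl

end LowFrequencies

/-! ### Absorption of constants and the union bound. -/

/-- With `y = x^{1/6}` this compares `y⁷` with `s y⁸`: either `y ≤ s⁻¹` or `s y ≥ 1`. It trades the
unknown factor `s` in the exponent for a multiplicative constant. -/
theorem rpow_seven_sixths_le {s x : ℝ} (hs : 0 < s) (hx : 0 ≤ x) :
    x ^ (1 + 1 / 6 : ℝ) ≤ s * x ^ (4 / 3 : ℝ) + s⁻¹ ^ 7 := by
  obtain ⟨y, hy⟩ : ∃ y, y = x ^ (1 / 6 : ℝ) := ⟨_, rfl⟩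
  have hy0 : 0 ≤ y := hy ▸ Real.rpow_nonneg hx _
  have h7 : x ^ (1 + 1 / 6 : ℝ) = y ^ 7 := by
    rw [hy, ← Real.rpow_mul_natCast hx]
    norm_num
  have h8 : x ^ (4 / 3 : ℝ) = y ^ 8 := by
    rw [hy, ← Real.rpow_mul_natCast hx]
    norm_num
  rw [h7, h8]
  rcases le_total y s⁻¹ with h | h
  · have : y ^ 7 ≤ s⁻¹ ^ 7 := by gcongr
    have : 0 ≤ s * y ^ 8 := by positivity
    linarith
  · have h1 : 1 ≤ s * y := by
      rwa [inv_le_iff_one_le_mul₀' hs] at h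
    have : 0 ≤ s⁻¹ ^ 7 := by positivity
    nlinarith [mul_le_mul_of_nonneg_right h1 (pow_nonneg hy0 7)]

theorem exp_neg_mul_log_rpow_le {s ε : ℝ} (hs : 0 < s) (h0 : 0 < ε) (h1 : ε < 1) :
    Real.exp (-(s * Real.log (1 / ε ^ 2) ^ (4 / 3 : ℝ))) ≤
      Real.exp (s⁻¹ ^ 7) * Real.exp (-(Real.log (1 / ε) ^ (1 + 1 / 6 : ℝ))) := by
  have hx := log_one_div_pos h0 h1
  rw [← Real.exp_add, Real.exp_le_exp, log_one_div_sq]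
  have h2 := rpow_seven_sixths_le hs hx.le
  have h3 : Real.log (1 / ε) ^ (4 / 3 : ℝ) ≤ (2 * Real.log (1 / ε)) ^ (4 / 3 : ℝ) := by
    gcongr
    linarith
  nlinarith [mul_le_mul_of_nonneg_left h3 hs.le]

section Probability

variable {Ω : Type*} [MeasurableSpace Ω] {P : Measure Ω} {B : ℝ → Ω → ℝ} {α : ℝ}

/-- Union bound for the exceedance of `d l^{α/2} (log (1/ε²))^{2/3}` by coefficients with the law of
the fractional noise. -/
theorem IsFractionalBrownianMotion.measureReal_le_of_subset (hα0 : 0 ≤ α) (hα1 : α ≤ 1)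
    (h : IsFractionalBrownianMotion (1 - α / 2) B P) {V : ℕ → Ω → ℂ}
    (hV : ∀ l : ℕ, 1 ≤ l → IdentDistrib (V l) (noiseFourier B l) P P) {ε d : ℝ} (h0 : 0 < ε)
    (h1 : ε < 1) (hd : 0 < d) (m : ℕ) {A : Set Ω}
    (hA : ∀ ω ∈ A, ∃ l : ℕ, 1 ≤ l ∧ l ≤ m ∧
      d * (l : ℝ) ^ (α / 2) * Real.log (1 / ε ^ 2) ^ (2 / 3 : ℝ) ≤ ‖V l ω‖) :
    P.real A ≤ 2 * Real.exp (((64 * Real.pi ^ 2)⁻¹ * d ^ 2)⁻¹ ^ 7) * m *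
      Real.exp (-(Real.log (1 / ε) ^ (1 + 1 / 6 : ℝ))) := by
  have := h.gaussian.isProbabilityMeasure
  have hL := log_one_div_sq_pos h0 h1
  obtain ⟨t, ht⟩ : ∃ t : ℕ → ℝ, t = fun l : ℕ =>
    d * (l : ℝ) ^ (α / 2) * Real.log (1 / ε ^ 2) ^ (2 / 3 : ℝ) := ⟨_, rfl⟩
  have hsub : A ⊆ ⋃ l ∈ Finset.Icc 1 m, {ω | t l ≤ ‖V l ω‖} := fun ω hω => by
    obtain ⟨l, h1, h2, h3⟩ := hA ω hω
    simp only [mem_iUnion, Finset.mem_Icc]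
    exact ⟨l, ⟨h1, h2⟩, by simpa only [ht, mem_ofPred_eq] using h3⟩
  have hterm : ∀ l ∈ Finset.Icc 1 m, P.real {ω | t l ≤ ‖V l ω‖} ≤
      2 * (Real.exp (((64 * Real.pi ^ 2)⁻¹ * d ^ 2)⁻¹ ^ 7) *
        Real.exp (-(Real.log (1 / ε) ^ (1 + 1 / 6 : ℝ)))) := by
    intro l hl
    have hl1 : 1 ≤ l := (Finset.mem_Icc.1 hl).1
    have hl' : (0 : ℝ) < l := by exact_mod_cast hl1
    have ht0 : 0 ≤ t l := by
      rw [ht]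
      positivity
    have hVm : P {ω | t l ≤ ‖V l ω‖} = P {ω | t l ≤ ‖noiseFourier B l ω‖} :=
      (hV l hl1).measure_mem_eq (s := {z : ℂ | t l ≤ ‖z‖})
        (measurableSet_le measurable_const measurable_norm)
    -- The factor `l^α` cancels, so every term of the union has the same bound.
    have hsq : t l ^ 2 / (l : ℝ) ^ α = d ^ 2 * Real.log (1 / ε ^ 2) ^ (4 / 3 : ℝ) := by
      have e1 : ((l : ℝ) ^ (α / 2)) ^ 2 = (l : ℝ) ^ α := by
        rw [← Real.rpow_mul_natCast hl'.le]
        norm_num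
      have e2 : (Real.log (1 / ε ^ 2) ^ (2 / 3 : ℝ)) ^ 2 = Real.log (1 / ε ^ 2) ^ (4 / 3 : ℝ) := by
        rw [← Real.rpow_mul_natCast hL.le]
        norm_num
      rw [ht, mul_pow, mul_pow, e1, e2]
      field_simp
    have htail := h.measure_noiseFourier_ge_le hα0 hα1 hl1 ht0
    rw [hsq, ← mul_assoc] at htail
    rw [Measure.real, hVm]
    refine (ENNReal.toReal_le_of_le_ofReal (by positivity) htail).trans ?_
    gcongr
    exact exp_neg_mul_log_rpow_le (by positivity) h0 h1
  calc P.real A ≤ P.real (⋃ l ∈ Finset.Icc 1 m, {ω | t l ≤ ‖V l ω‖}) :=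
        measureReal_mono hsub (measure_ne_top _ _)
    _ ≤ ∑ l ∈ Finset.Icc 1 m, P.real {ω | t l ≤ ‖V l ω‖} := measureReal_biUnion_finset_le _ _
    _ ≤ ∑ l ∈ Finset.Icc 1 m, 2 * (Real.exp (((64 * Real.pi ^ 2)⁻¹ * d ^ 2)⁻¹ ^ 7) *
        Real.exp (-(Real.log (1 / ε) ^ (1 + 1 / 6 : ℝ)))) := Finset.sum_le_sum hterm
    _ = _ := by
        rw [Finset.sum_const, Nat.card_Icc, nsmul_eq_mul, Nat.add_sub_cancel]
        ring

end Probability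

/-! ### Failure of `ℬ` or `ℳ` forces a large noise coefficient. -/

section Events

variable {Ω : Type*} {B : ℝ → Ω → ℝ} {κ : Measure ℝ} {K : ℝ → ℝ} {α ε c : ℝ}

theorem exists_le_norm_noiseFourier_of_notMem_eventB (h0 : 0 < ε)
    (hc : ∀ l : ℕ, 1 ≤ l → l ≤ Md κ K α ε →
      c * ((l : ℝ) ^ (α / 2) * ε ^ α * Real.log (1 / ε ^ 2) ^ (2 / 3 : ℝ)) ≤
        ‖kernelFourier κ K l‖) {ω : Ω} (hω : ω ∈ (eventB κ K α ε B)ᶜ) :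
    ∃ l : ℕ, 1 ≤ l ∧ l ≤ Md κ K α ε ∧
      c / 2 * (l : ℝ) ^ (α / 2) * Real.log (1 / ε ^ 2) ^ (2 / 3 : ℝ) ≤ ‖noiseFourier B l ω‖ := by
  simp only [eventB, mem_compl_iff, mem_ofPred_eq, not_forall, not_le, exists_prop] at hω
  obtain ⟨l, h1, h2, h3⟩ := hω
  refine ⟨l, h1, h2, ?_⟩
  have hεα : 0 < ε ^ α := by positivity
  rw [norm_mul, Complex.norm_real, Real.norm_of_nonneg hεα.le] at h3
  have := hc l h1 h2
  refine le_of_mul_le_mul_left ?_ hεα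
  linarith

/-- The powers `2/3 < 1 < 4/3` of `L` are well separated, so the noise must bridge the gap between
observed and true coefficient: at `M_d` if the stopping time is too late, at some `l < M_c` if it is
too early. -/
theorem exists_le_norm_of_notMem_eventM (h0 : 0 < ε) (hL : 8 ≤ Real.log (1 / ε ^ 2))
    (hc1 : c ≤ 1) (hMcd : Mc κ K α ε ≤ Md κ K α ε)
    (hne : (lowFrequencies α ε (2 / 3) fun l => ‖kernelFourier κ K l‖).Nonempty)
    {W : ℕ → Ω → ℂ} {ω : Ω} (hω : ω ∈ (eventM κ K α ε W)ᶜ) :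
    ∃ l : ℕ, 1 ≤ l ∧ l ≤ Md κ K α ε ∧
      c / 2 * (l : ℝ) ^ (α / 2) * Real.log (1 / ε ^ 2) ^ (2 / 3 : ℝ) ≤ ‖W l ω‖ := by
  have hεα : 0 < ε ^ α := by positivity
  -- The three thresholds become `y²`, `y³`, `y⁴`; `L ≥ 8` means `y ≥ 2`, so each is at least twice
  -- the previous one.
  obtain ⟨y, hy⟩ : ∃ y, y = Real.log (1 / ε ^ 2) ^ (1 / 3 : ℝ) := ⟨_, rfl⟩
  have hL0 : 0 ≤ Real.log (1 / ε ^ 2) := by linarith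
  have hy2 : 2 ≤ y := by
    have : (2 : ℝ) = 8 ^ (1 / 3 : ℝ) := by
      rw [show (8 : ℝ) = 2 ^ (3 : ℝ) by norm_num, ← Real.rpow_mul (by norm_num)]
      norm_num
    rw [hy, this]
    gcongr
  have e23 : Real.log (1 / ε ^ 2) ^ (2 / 3 : ℝ) = y ^ 2 := by
    rw [hy, ← Real.rpow_mul_natCast hL0]
    norm_num
  have e1 : Real.log (1 / ε ^ 2) ^ (1 : ℝ) = y ^ 3 := by
    rw [hy, ← Real.rpow_mul_natCast hL0]
    norm_num
  have e43 : Real.log (1 / ε ^ 2) ^ (4 / 3 : ℝ) = y ^ 4 := by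
    rw [hy, ← Real.rpow_mul_natCast hL0]
    norm_num
  have hy3 : 2 * y ^ 2 ≤ y ^ 3 := by nlinarith [sq_nonneg y]
  have hy4 : 2 * y ^ 3 ≤ y ^ 4 := by
    nlinarith [mul_le_mul_of_nonneg_right hy2 (pow_nonneg (by linarith : 0 ≤ y) 3)]
  have hnorm : ∀ l : ℕ, ‖((ε ^ α : ℝ) : ℂ) * W l ω‖ = ε ^ α * ‖W l ω‖ := fun l => by
    rw [norm_mul, Complex.norm_real, Real.norm_of_nonneg hεα.le]
  have key : ∀ l : ℕ, (l : ℝ) ^ (α / 2) * ε ^ α * (y ^ 2) ≤ ε ^ α * ‖W l ω‖ →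
      c / 2 * (l : ℝ) ^ (α / 2) * Real.log (1 / ε ^ 2) ^ (2 / 3 : ℝ) ≤ ‖W l ω‖ := by
    intro l hl
    rw [e23]
    have h1 : (l : ℝ) ^ (α / 2) * y ^ 2 ≤ ‖W l ω‖ :=
      le_of_mul_le_mul_left (by linarith) hεα
    have h2 : 0 ≤ (l : ℝ) ^ (α / 2) * y ^ 2 := by positivity
    nlinarith
  by_cases hM : (Mc κ K α ε : ℕ∞) ≤ stoppingTime κ K α ε W ω
  -- Too late: at `M_d` the observation exceeds `y³` but the kernel at most `y²`, in units of
  -- `l^{α/2} ε^α`.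
  · have hM2 : ¬ stoppingTime κ K α ε W ω ≤ (Md κ K α ε : ℕ∞) := fun h => hω ⟨hM, h⟩
    obtain ⟨hd1, hd2⟩ : Md κ K α ε ∈
      lowFrequencies α ε (2 / 3) fun l => ‖kernelFourier κ K l‖ := Nat.sInf_mem hne
    refine ⟨Md κ K α ε, hd1, le_rfl, key _ ?_⟩
    have hY : (Md κ K α ε : ℝ) ^ (α / 2) * ε ^ α * y ^ 3 < ‖observed κ K α ε W (Md κ K α ε) ω‖ := by
      by_contra! hle
      refine hM2 (iInf₂_le (Md κ K α ε) ⟨hd1, ?_⟩)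
      rwa [e1]
    have htri := norm_add_le (kernelFourier κ K (Md κ K α ε))
      (((ε ^ α : ℝ) : ℂ) * W (Md κ K α ε) ω)
    rw [hnorm] at htri
    simp only [e23] at hd2
    rw [observed] at hY
    have hp : 0 ≤ (Md κ K α ε : ℝ) ^ (α / 2) * ε ^ α := by positivity
    nlinarith [mul_le_mul_of_nonneg_left hy3 hp]
  -- Too early: some `l < M_c` has observation at most `y³` and kernel above `y⁴`, in the same
  -- units.
  · rw [not_le, stoppingTime] at hM
    simp only [iInf_lt_iff, Nat.cast_lt, exists_prop] at hM
    obtain ⟨l, ⟨hl1, hl2⟩, hl3⟩ := hM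
    refine ⟨l, hl1, hl3.le.trans hMcd, key _ ?_⟩
    have hk := lt_of_lt_sInf_lowFrequencies hl1 hl3
    simp only [e1] at hl2
    simp only [e43] at hk
    have htri := norm_sub_le (observed κ K α ε W l ω) (((ε ^ α : ℝ) : ℂ) * W l ω)
    rw [hnorm, observed, add_sub_cancel_right] at htri
    rw [observed] at hl2
    have hp : 0 ≤ (l : ℝ) ^ (α / 2) * ε ^ α := by positivity
    nlinarith [mul_le_mul_of_nonneg_left hy3 hp, mul_le_mul_of_nonneg_left hy4 hp,
      mul_nonneg hp (sq_nonneg y)]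

end Events

/-! ### Comparison of `M_d` with the fine resolution level. -/

section Asymptotics

variable {ε : ℕ → ℝ}

theorem exists_bounds_of_isTheta (hεpos : ∀ n, 1 ≤ n → 0 < ε n)
    (hε : ε =Θ[atTop] fun n : ℕ => (n : ℝ) ^ (-(1 / 2) : ℝ)) :
    ∃ c C : ℝ, 0 < c ∧ 0 < C ∧ ∀ᶠ n : ℕ in atTop,
      c * (n : ℝ) ^ (-(1 / 2) : ℝ) ≤ ε n ∧ ε n ≤ C * (n : ℝ) ^ (-(1 / 2) : ℝ) := by
  obtain ⟨C, hC, hC'⟩ := hε.1.exists_pos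
  obtain ⟨D, hD, hD'⟩ := hε.2.exists_pos
  refine ⟨D⁻¹, C, by positivity, hC, ?_⟩
  filter_upwards [hC'.bound, hD'.bound, eventually_ge_atTop 1] with n h1 h2 hn
  have hr : 0 ≤ (n : ℝ) ^ (-(1 / 2) : ℝ) := by positivity
  rw [Real.norm_of_nonneg (hεpos n hn).le, Real.norm_of_nonneg hr] at h1 h2
  exact ⟨by rwa [inv_mul_le_iff₀ hD], h1⟩

theorem eventually_log_le_log_one_div_sq (hεpos : ∀ n, 1 ≤ n → 0 < ε n) {C : ℝ} (hC : 0 < C)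
    (hε : ∀ᶠ n : ℕ in atTop, ε n ≤ C * (n : ℝ) ^ (-(1 / 2) : ℝ)) :
    ∀ᶠ n : ℕ in atTop, Real.log n / 2 ≤ Real.log (1 / ε n ^ 2) := by
  filter_upwards [hε, eventually_ge_atTop 1, (Real.tendsto_log_atTop.comp
    tendsto_natCast_atTop_atTop).eventually_ge_atTop (4 * Real.log C)] with n h1 hn h2
  have hn' : (0 : ℝ) < n := by exact_mod_cast hn
  have h3 := Real.log_le_log (hεpos n hn) h1
  rw [Real.log_mul hC.ne' (by positivity), Real.log_rpow hn'] at h3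
  rw [log_one_div_sq, one_div, Real.log_inv]
  simp only [Function.comp_apply] at h2
  linarith

/-- It suffices that `⌊2^{j₁}⌋` itself meets the threshold. As `(ν + α/2) / (α + 2ν) = 1/2`, the
powers of `n` cancel against `ε^α` and the logarithms leave `(log n)^{1/6}`. -/
theorem eventually_sInf_lowFrequencies_le {α ν b : ℝ} {k : ℕ → ℝ} (hα : 0 < α) (hν : 0 ≤ ν)
    (hεpos : ∀ n, 1 ≤ n → 0 < ε n)
    (hε : ε =Θ[atTop] fun n : ℕ => (n : ℝ) ^ (-(1 / 2) : ℝ))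
    (hk : ∀ l : ℕ, 1 ≤ l → k l ≤ b * (l : ℝ) ^ (-ν)) :
    ∀ᶠ n : ℕ in atTop, sInf (lowFrequencies α (ε n) (2 / 3) k) ≤ ⌊fineResolution α ν n⌋₊ := by
  obtain ⟨c, C, hc, hC, hcC⟩ := exists_bounds_of_isTheta hεpos hε
  have hlogt : Tendsto (fun n : ℕ => Real.log n) atTop atTop :=
    Real.tendsto_log_atTop.comp tendsto_natCast_atTop_atTop
  have hlogo : ∀ᶠ n : ℕ in atTop, ‖Real.log n‖ ≤ 1 * ‖(n : ℝ) ^ α‖ :=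
    ((isLittleO_log_rpow_atTop hα).comp_tendsto tendsto_natCast_atTop_atTop).bound one_pos
  obtain ⟨D, hD⟩ : ∃ D : ℝ, D = 2⁻¹ ^ (ν + α / 2) * c ^ α * 2⁻¹ ^ (2 / 3 : ℝ) := ⟨_, rfl⟩
  have hD0 : 0 < D := by
    rw [hD]
    positivity
  filter_upwards [hcC, eventually_log_le_log_one_div_sq hεpos hC (hcC.mono fun n h => h.2),
    hlogt.eventually_ge_atTop 1, hlogo, eventually_ge_atTop 1,
    ((tendsto_rpow_atTop (by norm_num : (0 : ℝ) < 1 / 6)).comp hlogt).eventually_ge_atTop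
      (b / D)] with n h1 h2 h3 h4 hn h5
  have hn' : (0 : ℝ) < n := by exact_mod_cast hn
  have hlog : 0 < Real.log n := by linarith
  rw [Real.norm_of_nonneg hlog.le, Real.norm_of_nonneg (by positivity), one_mul] at h4
  have hR1 : 1 ≤ fineResolution α ν n :=
    Real.one_le_rpow ((one_le_div hlog).2 h4) (by positivity)
  obtain ⟨m, hm⟩ : ∃ m, m = ⌊fineResolution α ν n⌋₊ := ⟨_, rfl⟩
  have hm1 : 1 ≤ m := hm ▸ (Nat.one_le_floor_iff _).2 hR1
  have hm1' : (1 : ℝ) ≤ m := by exact_mod_cast hm1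
  -- Rounding down loses at most a factor 2, because `m ≥ 1`.
  have hm2 : 2⁻¹ * fineResolution α ν n ≤ m := by
    have := Nat.lt_floor_add_one (fineResolution α ν n)
    rw [← hm] at this
    linarith
  rw [← hm]
  refine Nat.sInf_le ⟨hm1, (hk m hm1).trans ?_⟩
  have hRpow : fineResolution α ν n ^ (ν + α / 2) =
      (n : ℝ) ^ (α / 2) * (Real.log n ^ (1 / 2 : ℝ))⁻¹ := by
    rw [fineResolution, ← Real.rpow_mul (by positivity),
      show 1 / (α + 2 * ν) * (ν + α / 2) = 1 / 2 by field_simp; ring,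
      Real.div_rpow (by positivity) hlog.le, ← Real.rpow_mul hn'.le, div_eq_mul_inv]
    ring_nf
  have f1 : 2⁻¹ ^ (ν + α / 2) * ((n : ℝ) ^ (α / 2) * (Real.log n ^ (1 / 2 : ℝ))⁻¹) ≤
      (m : ℝ) ^ (ν + α / 2) := by
    rw [← hRpow, ← Real.mul_rpow (by norm_num) (by linarith)]
    exact Real.rpow_le_rpow (by linarith) hm2 (by positivity)
  have f2 : c ^ α * ((n : ℝ) ^ (α / 2))⁻¹ ≤ ε n ^ α := by
    have : ((n : ℝ) ^ (α / 2))⁻¹ = ((n : ℝ) ^ (-(1 / 2) : ℝ)) ^ α := by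
      rw [← Real.rpow_neg hn'.le, ← Real.rpow_mul hn'.le]
      ring_nf
    rw [this, ← Real.mul_rpow hc.le (by positivity)]
    exact Real.rpow_le_rpow (by positivity) h1.1 hα.le
  have f3 : 2⁻¹ ^ (2 / 3 : ℝ) * Real.log n ^ (2 / 3 : ℝ) ≤
      Real.log (1 / ε n ^ 2) ^ (2 / 3 : ℝ) := by
    rw [← Real.mul_rpow (by norm_num) hlog.le]
    exact Real.rpow_le_rpow (by positivity) (by linarith) (by norm_num)
  have hlogpow : Real.log n ^ (2 / 3 : ℝ) = Real.log n ^ (1 / 6 : ℝ) * Real.log n ^ (1 / 2 : ℝ) := by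
    rw [← Real.rpow_add hlog]
    norm_num
  have hεn := hεpos n hn
  have main : b ≤ (m : ℝ) ^ (ν + α / 2) * ε n ^ α * Real.log (1 / ε n ^ 2) ^ (2 / 3 : ℝ) := by
    rw [div_le_iff₀ hD0] at h5
    simp only [Function.comp_apply] at h5
    calc b ≤ Real.log n ^ (1 / 6 : ℝ) * D := h5
      _ = 2⁻¹ ^ (ν + α / 2) * ((n : ℝ) ^ (α / 2) * (Real.log n ^ (1 / 2 : ℝ))⁻¹) *
          (c ^ α * ((n : ℝ) ^ (α / 2))⁻¹) * (2⁻¹ ^ (2 / 3 : ℝ) * Real.log n ^ (2 / 3 : ℝ)) := by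
          have g1 : 0 < (n : ℝ) ^ (α / 2) := by positivity
          have g2 : 0 < Real.log n ^ (1 / 2 : ℝ) := by positivity
          rw [hD, hlogpow]
          field_simp
      _ ≤ _ := by gcongr
  have hmν : 0 < (m : ℝ) ^ (-ν) := by positivity
  calc b * (m : ℝ) ^ (-ν)
      ≤ (m : ℝ) ^ (ν + α / 2) * ε n ^ α * Real.log (1 / ε n ^ 2) ^ (2 / 3 : ℝ) * (m : ℝ) ^ (-ν) := by
        gcongr
    _ = ((m : ℝ) ^ (ν + α / 2) * (m : ℝ) ^ (-ν)) * ε n ^ α *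
        Real.log (1 / ε n ^ 2) ^ (2 / 3 : ℝ) := by ring
    _ = _ := by
        rw [← Real.rpow_add (by linarith)]
        ring_nf

end Asymptotics

end WaveletDeconv

/-! ### Assembly. -/

theorem mainTheorem2 (α ν : ℝ) (hα0 : 0 < α) (hα1 : α ≤ 1) (hν : 0 ≤ ν)
    (ε : ℕ → ℝ) (hεpos : ∀ n, 1 ≤ n → 0 < ε n)
    (hε : ε =Θ[atTop] fun n : ℕ => (n : ℝ) ^ (-(1 / 2) : ℝ))
    (κ : Measure ℝ) (K : ℝ → ℝ) (hK : Integrable K κ)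
    (hreg : WaveletDeconv.IsRegularSmooth ν κ K) :
    ∃ c ξ C : ℝ, ∃ N : ℕ, 0 < c ∧ 0 < ξ ∧ 0 < C ∧
      -- the minima that define `M_c` and `M_d` are over nonempty sets
      (∀ n : ℕ, 1 ≤ n → ε n < 1 → ∀ p : ℝ,
        (WaveletDeconv.lowFrequencies α (ε n) p
          fun l => ‖WaveletDeconv.kernelFourier κ K l‖).Nonempty) ∧
      (∀ n : ℕ, N ≤ n →
        WaveletDeconv.Mc κ K α (ε n) ≤ WaveletDeconv.Md κ K α (ε n) ∧
        WaveletDeconv.Md κ K α (ε n) ≤ ⌊WaveletDeconv.fineResolution α ν n⌋₊) ∧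
      ∀ {Ω : Type*} [MeasurableSpace Ω] (P : Measure Ω) [IsProbabilityMeasure P]
        (B : ℝ → Ω → ℝ) (W : ℕ → Ω → ℂ),
        WaveletDeconv.IsFractionalBrownianMotion (1 - α / 2) B P →
        (∀ l : ℕ, 1 ≤ l → IdentDistrib (W l) (WaveletDeconv.noiseFourier B l) P P) →
        (∀ l : ℕ, 1 ≤ l → IndepFun (W l) (WaveletDeconv.noiseFourier B l) P) →
        (∀ n : ℕ, 1 ≤ n → ε n < 1 →
          P.real (WaveletDeconv.eventB κ K α (ε n) B)ᶜ
            ≤ WaveletDeconv.tailBound κ K α (ε n) c ξ) ∧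
        (∀ n : ℕ, N ≤ n →
          P.real (WaveletDeconv.eventM κ K α (ε n) W)ᶜ
            ≤ C * WaveletDeconv.tailBound κ K α (ε n) c ξ) := by
  obtain ⟨a, b, ha, hb, hab⟩ := hreg.exists_bounds
  obtain ⟨d, hd0, hd1, hd⟩ :=
    WaveletDeconv.exists_mul_le_of_le_sInf_lowFrequencies hα0 hα1 hν ha hb hab
  obtain ⟨_, C, -, hC, hcC⟩ := WaveletDeconv.exists_bounds_of_isTheta hεpos hε
  have hne : ∀ n : ℕ, 1 ≤ n → ε n < 1 → ∀ p : ℝ, (WaveletDeconv.lowFrequencies α (ε n) p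
      fun l => ‖WaveletDeconv.kernelFourier κ K l‖).Nonempty := fun n hn h1 p =>
    WaveletDeconv.lowFrequencies_nonempty hα0 (hεpos n hn) h1 hν hb fun l hl => (hab l hl).2
  have hlarge : ∀ᶠ n : ℕ in atTop, 1 ≤ n ∧ 8 ≤ Real.log (1 / ε n ^ 2) ∧
      WaveletDeconv.Md κ K α (ε n) ≤ ⌊WaveletDeconv.fineResolution α ν n⌋₊ := by
    filter_upwards [eventually_ge_atTop 1,
      WaveletDeconv.eventually_log_le_log_one_div_sq hεpos hC (hcC.mono fun n h => h.2),
      (Real.tendsto_log_atTop.comp tendsto_natCast_atTop_atTop).eventually_ge_atTop 16,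
      WaveletDeconv.eventually_sInf_lowFrequencies_le hα0 hν hεpos hε
        fun l hl => (hab l hl).2] with n h1 h2 h3 h4
    simp only [Function.comp_apply] at h3
    exact ⟨h1, by linarith, h4⟩
  obtain ⟨N, hN⟩ := eventually_atTop.1 hlarge
  have hlt : ∀ n, N ≤ n → ε n < 1 := fun n hn => by
    obtain ⟨h1, h2, -⟩ := hN n hn
    by_contra! hge
    rw [WaveletDeconv.log_one_div_sq, one_div, Real.log_inv] at h2
    linarith [Real.log_nonneg hge]
  have hMcd : ∀ n, N ≤ n → WaveletDeconv.Mc κ K α (ε n) ≤ WaveletDeconv.Md κ K α (ε n) :=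
    fun n hn => by
      obtain ⟨h1, h2, -⟩ := hN n hn
      exact WaveletDeconv.sInf_lowFrequencies_anti (by norm_num) (by linarith) (hεpos n h1).le
        (hne n h1 (hlt n hn) _)
  -- Both events lead to exceedances with the same constant `d / 2`, so `C = 1` suffices.
  refine ⟨2 * Real.exp (((64 * Real.pi ^ 2)⁻¹ * (d / 2) ^ 2)⁻¹ ^ 7), 1 / 6, 1, N, by positivity,
    by norm_num, one_pos, hne, fun n hn => ⟨hMcd n hn, (hN n hn).2.2⟩, ?_⟩
  intro Ω _ P _ B W hB hW _
  refine ⟨fun n hn h1 => ?_, fun n hn => ?_⟩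
  · refine hB.measureReal_le_of_subset hα0.le hα1
      (fun l hl => IdentDistrib.refl (hW l hl).aemeasurable_snd) (hεpos n hn) h1 (half_pos hd0) _
      fun ω hω => ?_
    exact WaveletDeconv.exists_le_norm_noiseFourier_of_notMem_eventB (hεpos n hn)
      (hd _ (hεpos n hn) h1) hω
  · obtain ⟨h1, h2, -⟩ := hN n hn
    rw [one_mul]
    refine hB.measureReal_le_of_subset hα0.le hα1 hW (hεpos n h1) (hlt n hn) (half_pos hd0) _
      fun ω hω => ?_
    exact WaveletDeconv.exists_le_norm_of_notMem_eventM (hεpos n h1) h2 hd1 (hMcd n hn)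
      (hne n h1 (hlt n hn) _) hω
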